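/- A finite set $D$ of points (dots) of the square grid $\mathbb{Z}^2$ is a distinct difference configuration (DDC) if any two different lines joining pairs of dots of $D$ (unordered pairs of distinct dots) differ in their length or in their slope. Then $\sqrt{\tfrac{3\sqrt3}{2}}\,R+o(R)$ is a lower bound, for infinitely many values of $R$, on the maximum number of dots of a DDC in a regular hexagon with sides of length $R$. Precisely: for every orientation $\varphi\in\mathbb{R}$ there are positive reals $R_1,R_2,\dots$ with $R_k\to\infty$ and reals $e_k=o(R_k)$ such that, for every $k$ and every center $c\in\mathbb{R}^2$, the closed regular hexagon with side length $R_k$, center $c$ and vertices $c+R_k\bigl(\cos(\varphi+j\pi/3),\sin(\varphi+j\pi/3)\bigr)$, $0\le j\le 5$, contains a DDC with at least $\sqrt{\tfrac{3\sqrt3}{2}}\,R_k+e_k$ dots. -/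

import Mathlib

/-- Two segments of the square grid, one with end points `p, q` and one with end points `r, s`,
have the same (Euclidean) length. -/
def SameLength (p q r s : ℤ × ℤ) : Prop :=
  (q.1 - p.1) ^ 2 + (q.2 - p.2) ^ 2 = (s.1 - r.1) ^ 2 + (s.2 - r.2) ^ 2

/-- The lines through `p, q` and through `r, s` have the same slope (vertical lines included). -/
def SameSlope (p q r s : ℤ × ℤ) : Prop :=
  (q.2 - p.2) * (s.1 - r.1) = (s.2 - r.2) * (q.1 - p.1)

/-- A finite set of dots on the square grid is a distinct difference configuration if any two
different lines (unordered pairs of distinct dots) differ in their length or in their slope. -/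
def IsDDC (D : Finset (ℤ × ℤ)) : Prop :=
  ∀ p ∈ D, ∀ q ∈ D, ∀ r ∈ D, ∀ s ∈ D, p ≠ q → r ≠ s →
    SameLength p q r s → SameSlope p q r s → s(p, q) = s(r, s)

/-- The `k`-th vertex of the regular hexagon with center `c`, side length (equivalently,
circumradius) `R`, and orientation `φ`. -/
noncomputable def hexVertex (c : ℝ × ℝ) (φ R : ℝ) (k : Fin 6) : ℝ × ℝ :=
  (c.1 + R * Real.cos (φ + (k : ℕ) * (Real.pi / 3)),
   c.2 + R * Real.sin (φ + (k : ℕ) * (Real.pi / 3)))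

/-- The closed regular hexagon in the plane with center `c`, side length `R`, orientation `φ`. -/
noncomputable def regularHexagon (c : ℝ × ℝ) (φ R : ℝ) : Set (ℝ × ℝ) :=
  convexHull ℝ (Set.range (hexVertex c φ R))

open MeasureTheory
open scoped Pointwise

/-! For a prime `p` and a generator `ω` of `(ZMod p)ˣ`, send a grid point `v` to `(cross v g, ω ^
cross v u)` in `ZMod p × (ZMod p)ˣ`. The diagonal is a Sidon set there: a difference and a ratio `ρ
≠ 1` determine the pair of points. So are its `p` additive translates, which cover the whole group.
If the map is injective on a set `S`, some fibre is a DDC with at least `|S| / p` dots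
(`exists_isDDC_subset`).

Injectivity means that `S - S` meets the kernel lattice, of covolume about `p²`, only in 0. A
hexagon tiles the plane, so it is best to have the kernel close to the tiling lattice of a hexagon
of area `p²`. Suitable `g`, `u` exist for arbitrarily large `p` because lattices `⟨e + κ u, u⟩` with
rational `κ` are dense among unimodular ones (`exists_prime_forms`). A hexagon of side `R`, scaled
by `τ < 1` for safety, then holds about `τ² p²` grid points, whence about `τ² p = τ √(3√3/2) R`
dots. Only differences of points matter, so one `R` serves every center. -/

/-- The determinant of two plane vectors. -/
def cross {A : Type*} [CommRing A] (a b : A × A) : A := a.1 * b.2 - a.2 * b.1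

/-- The embedding of the square grid into the plane. -/
def toPlane (v : ℤ × ℤ) : ℝ × ℝ := ((v.1 : ℝ), (v.2 : ℝ))

theorem cast_cross {A : Type*} [CommRing A] (a b : ℤ × ℤ) :
    ((cross a b : ℤ) : A) = (a.1 : A) * b.2 - (a.2 : A) * b.1 := by
  simp [cross]

theorem cross_sub_left {A : Type*} [CommRing A] (a b d : A × A) :
    cross (a - b) d = cross a d - cross b d := by
  simp only [cross, Prod.fst_sub, Prod.snd_sub]; ring

/-! ### Lengths and slopes versus difference vectors -/

/-- Eliminating with the slope relation gives `a² = x²` and `b² = y²`; opposite sign choices in the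
two coordinates force `x * y = 0`, where the signs can be made to agree. -/
theorem eq_or_eq_neg_of_sq_add_sq_eq {a b x y : ℤ} (hl : a ^ 2 + b ^ 2 = x ^ 2 + y ^ 2)
    (hs : b * x = y * a) : (a = x ∧ b = y) ∨ (a = -x ∧ b = -y) := by
  have h1 : a ^ 2 * (x ^ 2 + y ^ 2) = x ^ 2 * (x ^ 2 + y ^ 2) := by
    linear_combination x ^ 2 * hl - (b * x + y * a) * hs
  have h2 : b ^ 2 * (x ^ 2 + y ^ 2) = y ^ 2 * (x ^ 2 + y ^ 2) := by
    linear_combination y ^ 2 * hl + (b * x + y * a) * hs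
  rcases eq_or_ne (x ^ 2 + y ^ 2) 0 with h0 | h0
  · have hx0 : x = 0 := by nlinarith [sq_nonneg x, sq_nonneg y]
    have hy0 : y = 0 := by nlinarith [sq_nonneg x, sq_nonneg y]
    have ha0 : a = 0 := by nlinarith [sq_nonneg a, sq_nonneg b]
    have hb0 : b = 0 := by nlinarith [sq_nonneg a, sq_nonneg b]
    simp [*]
  · rcases sq_eq_sq_iff_eq_or_eq_neg.1 (mul_right_cancel₀ h0 h1) with h3 | h3 <;>
    rcases sq_eq_sq_iff_eq_or_eq_neg.1 (mul_right_cancel₀ h0 h2) with h4 | h4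
    · exact Or.inl ⟨h3, h4⟩
    · have h5 : x * y = 0 := by rw [h3, h4] at hs; linarith
      rcases mul_eq_zero.1 h5 with h | h <;> simp [h3, h4, h]
    · have h5 : x * y = 0 := by rw [h3, h4] at hs; linarith
      rcases mul_eq_zero.1 h5 with h | h <;> simp [h3, h4, h]
    · exact Or.inr ⟨h3, h4⟩

theorem sub_eq_or_eq_neg_of_sameLength_of_sameSlope {p q r s : ℤ × ℤ}
    (hl : SameLength p q r s) (hs : SameSlope p q r s) :
    q - p = s - r ∨ q - p = r - s := by
  rw [← neg_sub s r]
  simpa only [Prod.ext_iff, Prod.fst_sub, Prod.snd_sub, Prod.fst_neg, Prod.snd_neg]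
    using eq_or_eq_neg_of_sq_add_sq_eq hl hs

/-- It suffices to look at equal difference vectors. -/
theorem isDDC_of_sub_eq {D : Finset (ℤ × ℤ)}
    (h : ∀ p ∈ D, ∀ q ∈ D, ∀ r ∈ D, ∀ s ∈ D, p ≠ q → q - p = s - r → p = r) : IsDDC D := by
  intro p hp q hq r hr s hs hpq _ hl hsl
  rcases sub_eq_or_eq_neg_of_sameLength_of_sameSlope hl hsl with e | e
  · have h1 := h p hp q hq r hr s hs hpq e
    subst h1
    rw [sub_left_inj.1 e]
  · have h1 := h p hp q hq s hs r hr hpq e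
    subst h1
    rw [sub_left_inj.1 e, Sym2.eq_swap]

/-! ### The Sidon set and the pigeonhole argument -/

/-- The set `{(x, x)}` is a Sidon set in `ZMod p × (ZMod p)ˣ`; its preimages under a map that is
injective on `D` are distinct difference configurations. -/
theorem isDDC_of_fiber {p : ℕ} [Fact p.Prime] {ω : (ZMod p)ˣ} (hω : orderOf ω = p - 1)
    (g u : ℤ × ℤ) (α : ZMod p) {D : Finset (ℤ × ℤ)}
    (hα : ∀ v ∈ D, ((ω ^ cross v u : (ZMod p)ˣ) : ZMod p) - ((cross v g : ℤ) : ZMod p) = α)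
    (hinj : ∀ v ∈ D, ∀ w ∈ D, (p : ℤ) ∣ cross (v - w) g → ((p - 1 : ℕ) : ℤ) ∣ cross (v - w) u →
      v = w) : IsDDC D := by
  have key : ∀ v ∈ D, ∀ w ∈ D, ω ^ cross v u = ω ^ cross w u → v = w := by
    intro v hv w hw h
    apply hinj v hv w hw
    · have h1 := (hα v hv).trans (hα w hw).symm
      rw [h, sub_right_inj] at h1
      rw [cross_sub_left, ← ZMod.intCast_zmod_eq_zero_iff_dvd]
      push_cast
      rw [h1, sub_self]
    · rw [zpow_eq_zpow_iff_modEq, hω] at h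
      rw [cross_sub_left]
      exact h.symm.dvd
  apply isDDC_of_sub_eq
  intro a ha b hb r hr s hs hab e
  have e1 : cross b g - cross a g = cross s g - cross r g := by
    rw [← cross_sub_left, ← cross_sub_left, e]
  have e2 : cross b u - cross a u = cross s u - cross r u := by
    rw [← cross_sub_left, ← cross_sub_left, e]
  -- The common ratio: subtracting the fibre equations gives `(ρ - 1) * ω ^ cross a u = (ρ - 1) * ω
  -- ^ cross r u`, and `ρ = 1` would force `a = b`.
  set ρ : (ZMod p)ˣ := ω ^ (cross b u - cross a u) with hρ
  have hb' : ω ^ cross b u = ρ * ω ^ cross a u := by rw [hρ, ← zpow_add]; congr 1; ring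
  have hs' : ω ^ cross s u = ρ * ω ^ cross r u := by rw [hρ, ← zpow_add]; congr 1; linarith
  have hρ1 : (ρ : ZMod p) - 1 ≠ 0 := by
    intro h
    have : ρ = 1 := Units.ext (by simpa using sub_eq_zero.1 h)
    rw [this, one_mul] at hb'
    exact hab (key b hb a ha hb').symm
  apply key a ha r hr
  apply Units.ext
  apply mul_left_cancel₀ hρ1
  have ka := hα a ha
  have kb := hα b hb
  have kr := hα r hr
  have ks := hα s hs
  rw [hb', Units.val_mul] at kb
  rw [hs', Units.val_mul] at ks
  have e1' : ((cross b g : ℤ) : ZMod p) - (cross a g : ℤ) = (cross s g : ℤ) - (cross r g : ℤ) := by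
    exact_mod_cast congrArg (Int.cast : ℤ → ZMod p) e1
  linear_combination kb - ka - ks + kr + e1'

/-- Pigeonhole: a set of grid points on which the two residues are jointly injective contains a
distinct difference configuration of at least the average size. -/
theorem exists_isDDC_subset {p : ℕ} [Fact p.Prime] (g u : ℤ × ℤ) (S : Finset (ℤ × ℤ))
    (hinj : ∀ v ∈ S, ∀ w ∈ S, (p : ℤ) ∣ cross (v - w) g → ((p - 1 : ℕ) : ℤ) ∣ cross (v - w) u →
      v = w) : ∃ D ⊆ S, IsDDC D ∧ (S.card : ℝ) / p ≤ D.card := by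
  obtain ⟨ω, hω⟩ := IsCyclic.exists_generator (α := (ZMod p)ˣ)
  have ho : orderOf ω = p - 1 := by
    rw [orderOf_eq_card_of_forall_mem_zpowers hω, Nat.card_eq_fintype_card, ZMod.card_units]
  have hp : 0 < p := (Fact.out : p.Prime).pos
  have hp' : (0 : ℝ) < p := by exact_mod_cast hp
  classical
  obtain ⟨α, -, hα⟩ := Finset.exists_le_card_fiber_of_nsmul_le_card_of_maps_to
    (s := S) (t := (Finset.univ : Finset (ZMod p))) (b := (S.card : ℝ) / p)
    (f := fun v => ((ω ^ cross v u : (ZMod p)ˣ) : ZMod p) - ((cross v g : ℤ) : ZMod p))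
    (fun _ _ => Finset.mem_univ _) ⟨0, Finset.mem_univ _⟩
    (by rw [Finset.card_univ, ZMod.card, nsmul_eq_mul, mul_div_cancel₀ _ hp'.ne'])
  refine ⟨_, Finset.filter_subset _ S, ?_, hα⟩
  refine isDDC_of_fiber ho g u α (fun v hv => (Finset.mem_filter.1 hv).2) ?_
  intro v hv w hw
  exact hinj v (Finset.mem_filter.1 hv).1 w (Finset.mem_filter.1 hw).1

/-! ### Density of the rational lattices -/

theorem exists_isCoprime_mul (A B : ℤ) : ∃ G a b : ℤ, IsCoprime a b ∧ A = G * a ∧ B = G * b := by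
  rcases eq_or_ne (Int.gcd A B) 0 with h | h
  · rw [Int.gcd_eq_zero_iff] at h
    exact ⟨0, 1, 0, isCoprime_one_left, by simp [h.1], by simp [h.2]⟩
  · obtain ⟨g, a, b, -, hab, h1, h2⟩ := Int.exists_gcd_one' (Nat.pos_of_ne_zero h)
    exact ⟨g, a, b, Int.isCoprime_iff_gcd_eq_one.2 hab, by rw [h1, mul_comm], by rw [h2, mul_comm]⟩

/-- Every plane vector is approximated by scaled primitive integer vectors. -/
theorem exists_primitive_approx (w : ℝ × ℝ) {Q : ℕ} (hQ : 0 < Q) :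
    ∃ (e u : ℤ × ℤ) (N : ℕ), Q ≤ N ∧ cross e u = 1 ∧
      |(u.1 : ℝ) / N - w.1| ≤ 2 / Q ∧ |(u.2 : ℝ) / N - w.2| ≤ 2 / Q := by
  obtain ⟨G, a, b, ⟨r, s, hab⟩, hA, hB⟩ := exists_isCoprime_mul ⌊Q * w.1⌋ ⌊Q * w.2⌋
  obtain ⟨K, hK⟩ : ∃ K : ℕ, K = s.natAbs + r.natAbs + 1 := ⟨_, rfl⟩
  have hQ' : (0 : ℝ) < Q := by exact_mod_cast hQ
  have hK' : (0 : ℝ) < K := by rw [hK]; positivity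
  have aux : ∀ (A t : ℤ) (x : ℝ), A = ⌊Q * x⌋ → t.natAbs ≤ K →
      |((K * A + t : ℤ) : ℝ) / (K * Q : ℕ) - x| ≤ 2 / Q := by
    intro A t x h1 h2
    have h3 : |(A : ℝ) - Q * x| ≤ 1 := by
      rw [h1, abs_le]
      constructor <;> linarith [Int.floor_le (Q * x), Int.lt_floor_add_one (Q * x)]
    have h4 : |(t : ℝ)| ≤ K := by
      rw [← Int.cast_abs, Int.abs_eq_natAbs]; exact_mod_cast h2
    have h5 : ((K * A + t : ℤ) : ℝ) / (K * Q : ℕ) - x = (K * (A - Q * x) + t) / (K * Q) := by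
      push_cast
      field_simp
      ring
    rw [h5, abs_div, abs_of_pos (mul_pos hK' hQ'), div_le_div_iff₀ (mul_pos hK' hQ') hQ']
    have h6 : |(K : ℝ) * (A - Q * x) + t| ≤ 2 * K := by
      refine (abs_add_le _ _).trans ?_
      rw [abs_mul, abs_of_pos hK']
      nlinarith
    nlinarith
  -- A large multiple of the floor vector is parallel to `(a, b)`; adding the Bézout vector `(-s,
  -- r)` makes the determinant 1, and `K` makes this correction negligible.
  refine ⟨(a, b), (K * ⌊Q * w.1⌋ + -s, K * ⌊Q * w.2⌋ + r), K * Q, ?_, ?_, ?_, ?_⟩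
  · exact Nat.le_mul_of_pos_left _ (by omega)
  · rw [hA, hB]
    simp only [cross]
    linear_combination hab
  · exact aux _ _ _ rfl (by rw [Int.natAbs_neg]; omega)
  · exact aux _ _ _ rfl (by omega)

/-- Unimodular lattices of the form `⟨e + κ u, u⟩`, with `(e, u)` a basis of the square grid and `κ`
rational, are dense among all unimodular lattices. -/
theorem exists_rational_lattice_approx {w₁ w₂ : ℝ × ℝ} (hw : cross w₁ w₂ = 1) {η : ℝ}
    (hη : 0 < η) :
    ∃ (e u : ℤ × ℤ) (N : ℕ) (κ : ℚ), cross e u = 1 ∧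
      |cross (toPlane e + (κ : ℝ) • toPlane u) w₂ - 1| < η ∧
      |cross w₁ (toPlane e + (κ : ℝ) • toPlane u)| < η ∧
      |cross w₁ (toPlane u - (N : ℝ) • (toPlane e + (κ : ℝ) • toPlane u)) - 1| < η ∧
      |cross (toPlane u - (N : ℝ) • (toPlane e + (κ : ℝ) • toPlane u)) w₂| < η := by
  obtain ⟨δ, hδ⟩ : ∃ δ, δ = min (η / 4) (1 / 4) := ⟨_, rfl⟩
  have hδ0 : 0 < δ := by rw [hδ]; positivity
  have hδ1 : δ ≤ η / 4 := by rw [hδ]; exact min_le_left _ _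
  have hδ2 : δ ≤ 1 / 4 := by rw [hδ]; exact min_le_right _ _
  set C : ℝ := |w₁.1| + |w₁.2| + |w₂.1| + |w₂.2| + 1 with hC
  have hC1 : 1 ≤ C := by
    rw [hC]; linarith [abs_nonneg w₁.1, abs_nonneg w₁.2, abs_nonneg w₂.1, abs_nonneg w₂.2]
  obtain ⟨Q, hQ⟩ := exists_nat_gt (2 * C / δ)
  have hQ0 : (0 : ℝ) < Q := lt_of_le_of_lt (by positivity) hQ
  obtain ⟨e, u, N, hN, heu, h1, h2⟩ := exists_primitive_approx w₁ (Nat.cast_pos.1 hQ0)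
  have hN' : (Q : ℝ) ≤ N := by exact_mod_cast hN
  have hN0 : (0 : ℝ) < N := hQ0.trans_le hN'
  have hQδ : 2 / (Q : ℝ) * C ≤ δ := by
    rw [div_lt_iff₀ hδ0] at hQ
    rw [div_mul_eq_mul_div, div_le_iff₀ hQ0]
    linarith
  have hQ2 : 0 ≤ 2 / (Q : ℝ) := by positivity
  -- `d` is `cross (u / N) w₂`, close to 1 because `u / N` is close to `w₁`.
  set d : ℝ := ((u.1 : ℝ) / N) * w₂.2 - ((u.2 : ℝ) / N) * w₂.1 with hd
  have bound : ∀ a b x y : ℝ, |a| ≤ 2 / Q → |b| ≤ 2 / Q → |x| + |y| ≤ C → |a * x - b * y| ≤ δ := by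
    intro a b x y ha hb hxy
    refine (abs_sub (a * x) (b * y)).trans ?_
    rw [abs_mul, abs_mul]
    nlinarith [abs_nonneg x, abs_nonneg y, mul_le_mul_of_nonneg_right ha (abs_nonneg x),
      mul_le_mul_of_nonneg_right hb (abs_nonneg y), mul_le_mul_of_nonneg_left hxy hQ2]
  have hd1 : |d - 1| ≤ δ := by
    have := bound _ _ w₂.2 w₂.1 h1 h2 (by rw [hC]; linarith [abs_nonneg w₁.1, abs_nonneg w₁.2])
    rw [← hw, hd]
    simp only [cross]
    convert this using 2
    ring
  have hd2 : |w₁.1 * ((u.2 : ℝ) / N) - w₁.2 * ((u.1 : ℝ) / N)| ≤ δ := by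
    have := bound _ _ w₁.1 w₁.2 h2 h1 (by rw [hC]; linarith [abs_nonneg w₂.1, abs_nonneg w₂.2])
    convert this using 2
    ring
  have hdpos : 3 / 4 ≤ d := by linarith [(abs_le.1 hd1).1]
  have hd0 : 0 < d := by linarith
  have hNinv : 1 / (d * N) ≤ δ := by
    rw [div_le_iff₀ (by positivity)]
    rw [div_lt_iff₀ hδ0] at hQ
    have hNδ : 2 ≤ N * δ := by nlinarith
    nlinarith
  have hdinv : |1 / d - 1| ≤ 2 * δ := by
    rw [show 1 / d - 1 = -(d - 1) / d by field_simp; ring, abs_div, abs_neg, abs_of_pos hd0,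
      div_le_iff₀ hd0]
    nlinarith
  have heu' : (e.1 : ℝ) * u.2 - e.2 * u.1 = 1 := by
    rw [← cast_cross, heu, Int.cast_one]
  -- The vectors `z` with `cross z u = 1` are exactly the `e + κ u`. Dividing `w₂` by `d` puts `z =
  -- (u - w₂ / d) / N` among them; it is near `w₁`, and `u - N z = w₂ / d` is near `w₂`.
  obtain ⟨κ₀, hk1, hk2⟩ : ∃ κ₀ : ℝ, (e.1 : ℝ) + κ₀ * u.1 = (u.1 - w₂.1 / d) / N ∧
      (e.2 : ℝ) + κ₀ * u.2 = (u.2 - w₂.2 / d) / N := by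
    have hdN : (u.1 : ℝ) * w₂.2 - u.2 * w₂.1 = d * N := by rw [hd]; field_simp
    have hz : ((u.1 - w₂.1 / d) / N) * u.2 - ((u.2 - w₂.2 / d) / N) * u.1 = 1 := by
      field_simp
      linear_combination hdN
    refine ⟨e.1 * ((u.2 - w₂.2 / d) / N) - e.2 * ((u.1 - w₂.1 / d) / N), ?_, ?_⟩
    · linear_combination ((u.1 - w₂.1 / d) / N) * heu' - e.1 * hz
    · linear_combination ((u.2 - w₂.2 / d) / N) * heu' - e.2 * hz
  set F : ℝ → ℝ × ℝ := fun κ => toPlane e + κ • toPlane u with hF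
  have hFc : Continuous F := by fun_prop
  have hc1 : Continuous fun κ => (F κ).1 := hFc.fst
  have hc2 : Continuous fun κ => (F κ).2 := hFc.snd
  have hF1 : (F κ₀).1 = (u.1 - w₂.1 / d) / N := by simp [hF, toPlane, hk1]
  have hF2 : (F κ₀).2 = (u.2 - w₂.2 / d) / N := by simp [hF, toPlane, hk2]
  have hopen : IsOpen {κ : ℝ | |cross (F κ) w₂ - 1| < η ∧ |cross w₁ (F κ)| < η ∧
      |cross w₁ (toPlane u - (N : ℝ) • F κ) - 1| < η ∧
      |cross (toPlane u - (N : ℝ) • F κ) w₂| < η} := by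
    simp only [cross, Set.ofPred_and, Prod.fst_sub, Prod.snd_sub, Prod.smul_fst, Prod.smul_snd,
      smul_eq_mul]
    refine IsOpen.inter (isOpen_lt ?_ ?_) (IsOpen.inter (isOpen_lt ?_ ?_) (IsOpen.inter
      (isOpen_lt ?_ ?_) (isOpen_lt ?_ ?_))) <;> fun_prop
  have hmem : κ₀ ∈ {κ : ℝ | |cross (F κ) w₂ - 1| < η ∧ |cross w₁ (F κ)| < η ∧
      |cross w₁ (toPlane u - (N : ℝ) • F κ) - 1| < η ∧
      |cross (toPlane u - (N : ℝ) • F κ) w₂| < η} := by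
    have hw' : w₁.1 * w₂.2 - w₁.2 * w₂.1 = 1 := hw
    simp only [cross, Set.mem_ofPred_eq, Prod.fst_sub, Prod.snd_sub, Prod.smul_fst, Prod.smul_snd,
      smul_eq_mul, hF1, hF2, mul_div_cancel₀ _ hN0.ne', toPlane, sub_sub_cancel]
    refine ⟨?_, ?_, ?_, ?_⟩
    · have : ((u.1 : ℝ) - w₂.1 / d) / N * w₂.2 - (u.2 - w₂.2 / d) / N * w₂.1 - 1 = d - 1 := by
        rw [hd]; ring
      rw [this]
      linarith
    · have : w₁.1 * (((u.2 : ℝ) - w₂.2 / d) / N) - w₁.2 * ((u.1 - w₂.1 / d) / N) =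
          (w₁.1 * ((u.2 : ℝ) / N) - w₁.2 * ((u.1 : ℝ) / N)) - 1 / (d * N) := by
        rw [← hw']; field_simp; ring
      rw [this]
      refine (abs_sub _ _).trans_lt ?_
      rw [abs_of_pos (show 0 < 1 / (d * N) by positivity)]
      linarith
    · have : w₁.1 * (w₂.2 / d) - w₁.2 * (w₂.1 / d) - 1 = 1 / d - 1 := by rw [← hw']; ring
      rw [this]
      linarith
    · have : w₂.1 / d * w₂.2 - w₂.2 / d * w₂.1 = 0 := by ring
      rw [this, abs_zero]
      exact hη
  obtain ⟨κ, hκ⟩ := Rat.denseRange_cast.exists_mem_open hopen ⟨κ₀, hmem⟩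
  exact ⟨e, u, N, κ, heu, hκ⟩

/-! ### The kernel lattice and its avoidance of a hexagon -/

/-- With `z = e + κ u` and `g = κ.den • z`, this puts the kernel inside the span of `(p - 1) z` and
`p u`. The congruence on `p` makes `(p - 1) z` integral. -/
theorem exists_combination_of_dvd {e u v : ℤ × ℤ} {κ : ℚ} {p : ℕ} (hp : 1 ≤ p)
    (heu : cross e u = 1) (hpκ : p ≡ 1 [MOD κ.den])
    (hg : (p : ℤ) ∣ cross v (κ.den * e.1 + κ.num * u.1, κ.den * e.2 + κ.num * u.2))
    (hu : ((p - 1 : ℕ) : ℤ) ∣ cross v u) :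
    ∃ s t : ℤ, toPlane v =
      (((p : ℝ) - 1) * t) • (toPlane e + (κ : ℝ) • toPlane u) - ((p : ℝ) * s) • toPlane u := by
  obtain ⟨t, ht⟩ := hu
  obtain ⟨s₀, hs₀⟩ := hg
  obtain ⟨c, hc⟩ := (Nat.modEq_iff_dvd' hp).1 hpκ.symm
  have hpc : (p : ℤ) = 1 + κ.den * c := by exact_mod_cast (by omega : p = 1 + κ.den * c)
  rw [hc] at ht
  push_cast at ht
  have hκ : (κ.den : ℝ) ≠ 0 := by exact_mod_cast κ.den_nz
  have hκ' : (κ : ℝ) = κ.num / κ.den := by exact_mod_cast (Rat.num_div_den κ).symm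
  rw [hpc] at hs₀
  simp only [cross] at ht hs₀ heu
  generalize κ.num = a at *
  generalize κ.den = q at *
  obtain ⟨v1, v2⟩ := v
  obtain ⟨e1, e2⟩ := e
  obtain ⟨u1, u2⟩ := u
  simp only at *
  have E1 : q * v1 = q * c * t * (q * e1 + a * u1) - (1 + q * c) * s₀ * u1 := by
    linear_combination (q * e1 + a * u1) * ht - u1 * hs₀ - q * v1 * heu
  have E2 : q * v2 = q * c * t * (q * e2 + a * u2) - (1 + q * c) * s₀ * u2 := by
    linear_combination (q * e2 + a * u2) * ht - u2 * hs₀ - q * v2 * heu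
  -- `E1` and `E2` show that `q` divides `s₀ * u1` and `s₀ * u2`; since `u` is primitive, `q`
  -- divides `s₀`.
  have hs : s₀ = q * (e1 * (c * t * (q * e2 + a * u2) - c * s₀ * u2 - v2)
      - e2 * (c * t * (q * e1 + a * u1) - c * s₀ * u1 - v1)) := by
    linear_combination (-s₀) * heu - e2 * E1 + e1 * E2
  obtain ⟨s, hs⟩ : ∃ s, s₀ = q * s := ⟨_, hs⟩
  refine ⟨s, t, ?_⟩
  have hpc' : (p : ℝ) = 1 + q * c := by exact_mod_cast hpc
  rw [hs] at E1 E2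
  have E1' : (q : ℝ) * v1 = q * c * t * (q * e1 + a * u1) - (1 + q * c) * (q * s) * u1 := by
    exact_mod_cast E1
  have E2' : (q : ℝ) * v2 = q * c * t * (q * e2 + a * u2) - (1 + q * c) * (q * s) * u2 := by
    exact_mod_cast E2
  rw [hκ', hpc']
  ext
  · simp only [toPlane, Prod.smul_mk, Prod.mk_add_mk, Prod.mk_sub_mk, smul_eq_mul]
    apply mul_left_cancel₀ hκ
    rw [E1']
    field_simp
    ring
  · simp only [toPlane, Prod.smul_mk, Prod.mk_add_mk, Prod.mk_sub_mk, smul_eq_mul]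
    apply mul_left_cancel₀ hκ
    rw [E2']
    field_simp
    ring

/-- A nonzero integer vector stays outside the hexagon `|X - Y|, |X + 2 Y|, |2 X + Y| ≤ 2 τ` when it
is moved by a small fraction of its length. -/
theorem eq_zero_of_near_of_abs_le {x y : ℤ} {X Y η τ : ℝ}
    (hX : |X - x| ≤ η * (|(x : ℝ)| + |(y : ℝ)|)) (hY : |Y - y| ≤ η * (|(x : ℝ)| + |(y : ℝ)|))
    (h₁ : |X - Y| ≤ 2 * τ) (h₂ : |X + 2 * Y| ≤ 2 * τ) (h₃ : |2 * X + Y| ≤ 2 * τ)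
    (hη : 0 ≤ η) (hτ : τ < 1 - 3 * η) (hη' : 3 * η ≤ 1) : x = 0 ∧ y = 0 := by
  by_contra hne
  obtain ⟨S, hS⟩ : ∃ S : ℝ, S = |(x : ℝ)| + |(y : ℝ)| := ⟨_, rfl⟩
  rw [← hS] at hX hY
  have key : ∀ M : ℤ, 2 ≤ |M| → |x| + |y| ≤ |M| → |(M : ℝ)| ≤ 2 * τ + 3 * (η * S) → False := by
    intro M hM hMS hb
    have hM' : (2 : ℝ) ≤ |(M : ℝ)| := by exact_mod_cast hM
    have hMS' : S ≤ |(M : ℝ)| := by rw [hS]; exact_mod_cast hMS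
    nlinarith [mul_le_mul_of_nonneg_left hMS' hη]
  rw [abs_le] at hX hY h₁ h₂ h₃
  have k1 := key (x - y)
  have k2 := key (x + 2 * y)
  have k3 := key (2 * x + y)
  have b1 : |((x - y : ℤ) : ℝ)| ≤ 2 * τ + 3 * (η * S) := by
    push_cast; rw [abs_le]; constructor <;> nlinarith
  have b2 : |((x + 2 * y : ℤ) : ℝ)| ≤ 2 * τ + 3 * (η * S) := by
    push_cast; rw [abs_le]; constructor <;> linarith
  have b3 : |((2 * x + y : ℤ) : ℝ)| ≤ 2 * τ + 3 * (η * S) := by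
    push_cast; rw [abs_le]; constructor <;> linarith
  -- For a nonzero integer vector, one of the three forms has absolute value at least 2 and at least
  -- `|x| + |y|`: `x - y` for opposite signs, one of the others otherwise.
  grind

/-- For arbitrarily large primes `p` there are two linear forms, one read modulo `p` and one modulo
`p - 1`, whose common zeros form, up to a small error, the lattice `p ⟨w₁, w₂⟩`; stated for
its nonzero vectors avoiding a hexagon. -/
theorem exists_prime_forms {w₁ w₂ : ℝ × ℝ} (hw : cross w₁ w₂ = 1) {τ : ℝ} (hτ0 : 0 ≤ τ)
    (hτ : τ < 1) (M : ℕ) :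
    ∃ (p : ℕ) (g u : ℤ × ℤ), p.Prime ∧ M < p ∧ ∀ v : ℤ × ℤ,
      (p : ℤ) ∣ cross v g → ((p - 1 : ℕ) : ℤ) ∣ cross v u →
      |cross (toPlane v) w₂ - cross w₁ (toPlane v)| ≤ 2 * τ * p →
      |cross (toPlane v) w₂ + 2 * cross w₁ (toPlane v)| ≤ 2 * τ * p →
      |2 * cross (toPlane v) w₂ + cross w₁ (toPlane v)| ≤ 2 * τ * p → v = 0 := by
  obtain ⟨η, hη⟩ : ∃ η, η = (1 - τ) / 10 := ⟨_, rfl⟩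
  have hη0 : 0 < η := by rw [hη]; linarith
  obtain ⟨e, u, N, κ, heu, h1, h2, h3, h4⟩ := exists_rational_lattice_approx hw hη0
  -- This size of `p` gives `|t| / p ≤ η S`, as `t = x + s N`.
  obtain ⟨P, hP⟩ := exists_nat_gt ((N + 1) / η)
  obtain ⟨p, hp, hpM, hpκ⟩ := Nat.exists_prime_gt_modEq_one (max M P) κ.den_nz
  refine ⟨p, (κ.den * e.1 + κ.num * u.1, κ.den * e.2 + κ.num * u.2), u, hp,
    (le_max_left _ _).trans_lt hpM, ?_⟩
  intro v hvg hvu b1 b2 b3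
  obtain ⟨s, t, hv⟩ := exists_combination_of_dvd hp.one_le heu hpκ hvg hvu
  have hp0 : (0 : ℝ) < p := by exact_mod_cast hp.pos
  have hpP : (N + 1) / η < p :=
    hP.trans (by exact_mod_cast (le_max_right M P).trans_lt hpM)
  rw [div_lt_iff₀ hη0] at hpP
  set z := toPlane e + (κ : ℝ) • toPlane u with hz
  set w := toPlane u - (N : ℝ) • z with hwdef
  obtain ⟨x, hx⟩ : ∃ x : ℤ, x = t - s * N := ⟨_, rfl⟩
  obtain ⟨T, hT⟩ : ∃ T : ℝ, T = t / p := ⟨_, rfl⟩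
  have hx' : (x : ℝ) = t - s * N := by rw [hx]; push_cast; ring
  have hTp : T * p = t := by rw [hT]; field_simp
  -- Substituting `u = w + N z` passes to the basis `z ≈ w₁`, `w ≈ w₂`; the shift `T` is the cost of
  -- having `p - 1` in place of `p`.
  have hv' : toPlane v = (p : ℝ) • ((x - T) • z + ((-s : ℤ) : ℝ) • w) := by
    rw [hv, hwdef, hx', ← hTp]
    push_cast
    module
  set S : ℝ := |(x : ℝ)| + |((-s : ℤ) : ℝ)| with hS
  have hxS : |(x : ℝ)| ≤ S := by rw [hS]; linarith [abs_nonneg ((-s : ℤ) : ℝ)]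
  have hS0 : 0 ≤ S := by positivity
  have hTS : |T| ≤ η * S := by
    rw [hT, abs_div, abs_of_pos hp0, div_le_iff₀ hp0]
    have h5 : |(t : ℝ)| ≤ (N + 1) * S := by
      rw [show (t : ℝ) = x - ((-s : ℤ) : ℝ) * N by rw [hx']; push_cast; ring]
      refine (abs_sub (x : ℝ) _).trans ?_
      rw [abs_mul, Nat.abs_cast]
      have hN : (0 : ℝ) ≤ N := Nat.cast_nonneg N
      have : |((-s : ℤ) : ℝ)| ≤ S := by rw [hS]; linarith [abs_nonneg (x : ℝ)]
      nlinarith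
    nlinarith
  have aux : ∀ a b α β : ℝ, |α| < η → |β| < η → |a| + |b| = S →
      |(a - T) * α + b * β| ≤ 2 * (η * S) := by
    intro a b α β hα hβ hab
    refine (abs_add_le _ _).trans ?_
    rw [abs_mul, abs_mul]
    have h6 : |a - T| ≤ |a| + η * S := (abs_sub a T).trans (by linarith)
    have h7 : |a - T| * |α| ≤ (|a| + η * S) * η :=
      mul_le_mul h6 hα.le (abs_nonneg _) (by positivity)
    have h8 : |b| * |β| ≤ |b| * η := mul_le_mul_of_nonneg_left hβ.le (abs_nonneg _)
    have h9 : η * S * η ≤ η * S := by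
      have : η ≤ 1 := by rw [hη]; linarith
      nlinarith [mul_nonneg hη0.le hS0]
    nlinarith
  have hX : cross (toPlane v) w₂ / p - x =
      ((x - T) * (cross z w₂ - 1) + ((-s : ℤ) : ℝ) * cross w w₂) - T := by
    rw [hv']
    simp only [cross, Prod.smul_fst, Prod.smul_snd, Prod.fst_add, Prod.snd_add, smul_eq_mul]
    field_simp
    ring
  have hY : cross w₁ (toPlane v) / p - ((-s : ℤ) : ℝ) =
      (x - T) * cross w₁ z + ((-s : ℤ) : ℝ) * (cross w₁ w - 1) := by
    rw [hv']
    simp only [cross, Prod.smul_fst, Prod.smul_snd, Prod.fst_add, Prod.snd_add, smul_eq_mul]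
    field_simp
    ring
  have hdiv : ∀ r : ℝ, |r| ≤ 2 * τ * p → |r / p| ≤ 2 * τ := by
    intro r hr
    rwa [abs_div, abs_of_pos hp0, div_le_iff₀ hp0]
  -- The basis error contributes `2 η S` and `T` contributes `η S`; since `1 - τ = 10 η`, the
  -- required `τ < 1 - 9 η` holds.
  obtain ⟨hx0, hs0⟩ := eq_zero_of_near_of_abs_le (x := x) (y := -s) (η := 3 * η) (τ := τ)
    (X := cross (toPlane v) w₂ / p) (Y := cross w₁ (toPlane v) / p)
    (by
      rw [hX]
      refine (abs_sub _ T).trans ?_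
      linarith [aux x ((-s : ℤ) : ℝ) _ _ h1 h4 rfl])
    (by
      rw [hY]
      refine (aux x ((-s : ℤ) : ℝ) _ _ h2 h3 rfl).trans ?_
      nlinarith [mul_nonneg hη0.le hS0])
    (by convert hdiv _ b1 using 2; ring) (by convert hdiv _ b2 using 2; ring)
    (by convert hdiv _ b3 using 2; ring) (by positivity) (by rw [hη]; linarith)
    (by rw [hη]; linarith)
  have hs0' : s = 0 := by omega
  have ht0 : t = 0 := by rw [hx0, hs0'] at hx; omega
  rw [hs0', ht0] at hv
  simpa [toPlane, Prod.ext_iff] using hv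


/-! ### Linear coordinates on the regular hexagon -/

/-- The unit vector at angle `φ`. -/
noncomputable def unitVec (φ : ℝ) : ℝ × ℝ := (Real.cos φ, Real.sin φ)

/-- The hexagon with its center at the origin and vertices `(1, 0), (0, 1), (-1, 1), …`, scaled by
`R`: the coordinates of a regular hexagon with respect to two adjacent vertices. -/
def hexCoords (R : ℝ) : Set (ℝ × ℝ) := {a | |a.1| ≤ R ∧ |a.2| ≤ R ∧ |a.1 + a.2| ≤ R}

/-- The linear map whose columns are two adjacent vertices of the unit hexagon. -/
noncomputable def hexMap (φ : ℝ) : ℝ × ℝ →ₗ[ℝ] ℝ × ℝ :=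
  Matrix.toLin (Module.Basis.finTwoProd ℝ) (Module.Basis.finTwoProd ℝ)
    !![(unitVec φ).1, (unitVec (φ + Real.pi / 3)).1; (unitVec φ).2, (unitVec (φ + Real.pi / 3)).2]

theorem hexMap_apply (φ : ℝ) (a : ℝ × ℝ) :
    hexMap φ a = a.1 • unitVec φ + a.2 • unitVec (φ + Real.pi / 3) := by
  ext <;> simp [hexMap, Matrix.toLin_finTwoProd_apply] <;> ring

theorem cross_unitVec (φ : ℝ) : cross (unitVec φ) (unitVec (φ + Real.pi / 3)) = √3 / 2 := by
  have : cross (unitVec φ) (unitVec (φ + Real.pi / 3)) = Real.sin (φ + Real.pi / 3 - φ) := by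
    rw [Real.sin_sub]; simp only [cross, unitVec]; ring
  rw [this, add_sub_cancel_left, Real.sin_pi_div_three]

theorem det_hexMap (φ : ℝ) : LinearMap.det (hexMap φ) = √3 / 2 := by
  rw [hexMap, LinearMap.det_toLin, Matrix.det_fin_two_of, ← cross_unitVec φ, cross]
  ring

theorem unitVec_add_two_mul (θ : ℝ) :
    unitVec (θ + 2 * (Real.pi / 3)) = unitVec (θ + Real.pi / 3) - unitVec θ := by
  have h : θ + 2 * (Real.pi / 3) = (θ + Real.pi / 3) + Real.pi / 3 := by ring
  have h' : unitVec θ = unitVec ((θ + Real.pi / 3) - Real.pi / 3) := by rw [add_sub_cancel_right]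
  rw [h, h']
  generalize θ + Real.pi / 3 = x
  ext <;> simp only [unitVec, Prod.mk_sub_mk, Real.cos_add, Real.sin_add, Real.cos_sub,
    Real.sin_sub, Real.cos_pi_div_three, Real.sin_pi_div_three] <;> ring

theorem unitVec_add_pi (θ : ℝ) : unitVec (θ + Real.pi) = -unitVec θ := by
  ext <;> simp [unitVec]

theorem hexVertex_eq (c : ℝ × ℝ) (φ R : ℝ) (k : Fin 6) :
    hexVertex c φ R k = c + R • unitVec (φ + (k : ℕ) * (Real.pi / 3)) := rfl

/-- The coordinates of the six vertices with respect to the first two. -/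
theorem hexVertex_eq_hexMap (c : ℝ × ℝ) (φ R : ℝ) :
    hexVertex c φ R = ![c + hexMap φ (R, 0), c + hexMap φ (0, R), c + hexMap φ (-R, R),
      c + hexMap φ (-R, 0), c + hexMap φ (0, -R), c + hexMap φ (R, -R)] := by
  funext k
  rw [hexVertex_eq]
  simp only [hexMap_apply]
  fin_cases k
  · simp
  · simp
  · simp only [Fin.reduceFinMk, Nat.cast_ofNat, Matrix.cons_val, unitVec_add_two_mul]
    module
  · have h : φ + 3 * (Real.pi / 3) = φ + Real.pi := by ring
    simp [h, unitVec_add_pi]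
  · have h : φ + 4 * (Real.pi / 3) = (φ + Real.pi / 3) + Real.pi := by ring
    simp [h, unitVec_add_pi]
  · have h : φ + 5 * (Real.pi / 3) = (φ + 2 * (Real.pi / 3)) + Real.pi := by ring
    simp only [Fin.reduceFinMk, Nat.cast_ofNat, Matrix.cons_val, h, unitVec_add_pi,
      unitVec_add_two_mul]
    module

theorem exists_hexCoords_of_mem_regularHexagon {c q : ℝ × ℝ} {φ R : ℝ} (hR : 0 ≤ R)
    (hq : q ∈ regularHexagon c φ R) : ∃ a ∈ hexCoords R, q = c + hexMap φ a := by
  have hconv : Convex ℝ (hexCoords R) := by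
    intro a ha b hb s t hs ht hst
    simp only [hexCoords, Set.mem_ofPred_eq, abs_le, Prod.fst_add, Prod.snd_add, Prod.smul_fst,
      Prod.smul_snd, smul_eq_mul] at *
    refine ⟨⟨?_, ?_⟩, ⟨?_, ?_⟩, ⟨?_, ?_⟩⟩ <;>
    · obtain rfl : t = 1 - s := by linarith
      nlinarith
  have h2 : Convex ℝ ((fun x => c + x) '' (hexMap φ '' hexCoords R)) :=
    (hconv.linear_image _).translate c
  have h3 : regularHexagon c φ R ⊆ (fun x => c + x) '' (hexMap φ '' hexCoords R) := by
    refine convexHull_min ?_ h2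
    rintro _ ⟨k, rfl⟩
    have : ∀ a ∈ hexCoords R, c + hexMap φ a ∈ (fun x => c + x) '' (hexMap φ '' hexCoords R) :=
      fun a ha => ⟨_, ⟨a, ha, rfl⟩, rfl⟩
    rw [hexVertex_eq_hexMap]
    fin_cases k <;> refine this _ ?_ <;> simp [hexCoords, abs_of_nonneg hR, hR]
  obtain ⟨_, ⟨a, ha, rfl⟩, rfl⟩ := h3 hq
  exact ⟨a, ha, rfl⟩

theorem mem_regularHexagon_of_mem_hexCoords {c a : ℝ × ℝ} {φ R : ℝ}
    (ha : a ∈ hexCoords R) : c + hexMap φ a ∈ regularHexagon c φ R := by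
  have hv : ∀ k, hexVertex c φ R k ∈ regularHexagon c φ R :=
    fun k => subset_convexHull ℝ _ ⟨k, rfl⟩
  have hconv : Convex ℝ (regularHexagon c φ R) := convex_convexHull ℝ _
  rw [hexVertex_eq_hexMap] at hv
  have v0 := hv 0
  have v1 := hv 1
  have v2 := hv 2
  have v3 := hv 3
  have v4 := hv 4
  have v5 := hv 5
  simp only [Matrix.cons_val] at v0 v1 v2 v3 v4 v5
  obtain ⟨x, y⟩ := a
  obtain ⟨hx, hy, hxy⟩ := ha
  simp only [abs_le] at hx hy hxy
  have hR : 0 ≤ R := by linarith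
  have hmid : c ∈ regularHexagon c φ R := by
    have := hconv v0 v3 (by norm_num : (0 : ℝ) ≤ 1 / 2) (by norm_num : (0 : ℝ) ≤ 1 / 2) (by norm_num)
    convert this using 1
    simp only [hexMap_apply]
    module
  rcases hR.eq_or_lt with rfl | hR
  · obtain rfl : x = 0 := by linarith
    obtain rfl : y = 0 := by linarith
    simpa [hexMap_apply] using hmid
  -- The signs of `x`, `y`, `x + y` select one of the six triangles spanned by the center and two
  -- adjacent vertices.
  have tri : ∀ (p q : ℝ × ℝ) (s t : ℝ), c + hexMap φ p ∈ regularHexagon c φ R →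
      c + hexMap φ q ∈ regularHexagon c φ R → 0 ≤ s → 0 ≤ t → s + t ≤ R →
      (x, y) = (s / R) • p + (t / R) • q → c + hexMap φ (x, y) ∈ regularHexagon c φ R := by
    intro p q s t hp hq hs ht hst h
    have hsum : s / R + t / R ≤ 1 := by rw [← add_div, div_le_one hR]; exact hst
    have := hconv.sum_mem (t := (Finset.univ : Finset (Fin 3)))
      (w := ![s / R, t / R, 1 - (s / R + t / R)])
      (z := ![c + hexMap φ p, c + hexMap φ q, c])
      (by intro i _; fin_cases i <;> simp <;> first | positivity | linarith)
      (by simp [Fin.sum_univ_three])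
      (by intro i _; fin_cases i <;> simp [hp, hq, hmid])
    convert this using 1
    rw [h, map_add, map_smul, map_smul]
    simp only [Fin.sum_univ_three, Matrix.cons_val]
    module
  rcases le_total 0 x with h1 | h1 <;> rcases le_total 0 y with h2 | h2
  · refine tri _ _ x y v0 v1 h1 h2 hxy.2 ?_
    ext <;> simp <;> field_simp
  · rcases le_total 0 (x + y) with h3 | h3
    · refine tri _ _ (x + y) (-y) v0 v5 h3 (by linarith) (by linarith) ?_
      ext <;> simp <;> field_simp; simp
    · refine tri _ _ x (-(x + y)) v5 v4 h1 (by linarith) (by linarith) ?_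
      ext <;> simp <;> field_simp; simp
  · rcases le_total 0 (x + y) with h3 | h3
    · refine tri _ _ (x + y) (-x) v1 v2 h3 (by linarith) (by linarith) ?_
      ext <;> simp <;> field_simp; simp
    · refine tri _ _ y (-(x + y)) v2 v3 h2 (by linarith) (by linarith) ?_
      ext <;> simp <;> field_simp; simp
  · refine tri _ _ (-x) (-y) v3 v4 (by linarith) (by linarith) (by linarith) ?_
    ext <;> simp <;> field_simp

/-! ### Area and the number of grid points -/

theorem le_volume_hexCoords_one : ENNReal.ofReal 3 ≤ volume (hexCoords 1) := by
  -- Two trapezoids of area `3 / 2`, one on each side of the vertical axis.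
  have h1 : regionBetween (fun _ : ℝ => (-1 : ℝ)) (fun x => 1 - x) (Set.Ioc 0 1) ∪
      regionBetween (fun x : ℝ => -1 - x) (fun _ => 1) (Set.Ioc (-1) 0) ⊆ hexCoords 1 := by
    rintro ⟨x, y⟩ (⟨hx, hy⟩ | ⟨hx, hy⟩) <;>
    · simp only [Set.mem_Ioc, Set.mem_Ioo] at hx hy
      simp only [hexCoords, Set.mem_ofPred_eq, abs_le]
      refine ⟨⟨?_, ?_⟩, ⟨?_, ?_⟩, ⟨?_, ?_⟩⟩ <;> linarith
  have hdisj : Disjoint (regionBetween (fun _ : ℝ => (-1 : ℝ)) (fun x => 1 - x) (Set.Ioc 0 1))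
      (regionBetween (fun x : ℝ => -1 - x) (fun _ => 1) (Set.Ioc (-1) 0)) := by
    rw [Set.disjoint_left]
    rintro ⟨x, y⟩ ⟨hx, -⟩ ⟨hx', -⟩
    exact absurd hx.1 (not_lt.2 hx'.2)
  have m1 : volume (regionBetween (fun _ : ℝ => (-1 : ℝ)) (fun x => 1 - x) (Set.Ioc 0 1)) =
      ENNReal.ofReal (3 / 2) := by
    rw [Measure.volume_eq_prod, volume_regionBetween_eq_integral
      (continuous_const.integrableOn_Ioc)
      ((by fun_prop : Continuous fun x : ℝ => 1 - x).integrableOn_Ioc)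
      measurableSet_Ioc (fun x hx => by linarith [hx.2]),
      ← intervalIntegral.integral_of_le (by norm_num)]
    congr 1
    have h : ((fun x => 1 - x) - fun _ => -1 : ℝ → ℝ) = fun x => 2 - x := by
      funext x; simp only [Pi.sub_apply]; ring
    rw [h, intervalIntegral.integral_sub (by simp) (by simp), integral_id]
    norm_num
  have m2 : volume (regionBetween (fun x : ℝ => -1 - x) (fun _ => 1) (Set.Ioc (-1) 0)) =
      ENNReal.ofReal (3 / 2) := by
    rw [Measure.volume_eq_prod, volume_regionBetween_eq_integral
      ((by fun_prop : Continuous fun x : ℝ => -1 - x).integrableOn_Ioc)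
      (continuous_const.integrableOn_Ioc)
      measurableSet_Ioc (fun x hx => by linarith [hx.1]),
      ← intervalIntegral.integral_of_le (by norm_num)]
    congr 1
    have h : ((fun _ => 1) - fun x => -1 - x : ℝ → ℝ) = fun x => 2 + x := by
      funext x; simp only [Pi.sub_apply]; ring
    rw [h, intervalIntegral.integral_add (by simp) (by simp), integral_id]
    norm_num
  calc ENNReal.ofReal 3 = ENNReal.ofReal (3 / 2) + ENNReal.ofReal (3 / 2) := by
        rw [← ENNReal.ofReal_add] <;> norm_num
    _ ≤ _ := by
        nth_rw 1 [← m1]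
        rw [← m2, ← measure_union hdisj]
        · exact measure_mono h1
        · exact measurableSet_regionBetween (by fun_prop) (by fun_prop) measurableSet_Ioc

theorem le_volume_image_hexCoords (φ : ℝ) {R : ℝ} (hR : 0 ≤ R) :
    ENNReal.ofReal (3 * √3 / 2 * R ^ 2) ≤ volume (hexMap φ '' hexCoords R) := by
  have h : R • hexCoords 1 ⊆ hexCoords R := by
    rintro _ ⟨a, ⟨h1, h2, h3⟩, rfl⟩
    simp only [hexCoords, Set.mem_ofPred_eq, Prod.smul_fst, Prod.smul_snd, smul_eq_mul, ← mul_add,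
      abs_mul, abs_of_nonneg hR]
    exact ⟨mul_le_of_le_one_right hR h1, mul_le_of_le_one_right hR h2,
      mul_le_of_le_one_right hR h3⟩
  have h2 : volume (R • hexCoords 1) = ENNReal.ofReal (R ^ 2) * volume (hexCoords 1) := by
    rw [Measure.addHaar_smul]
    simp [abs_of_nonneg (pow_nonneg hR 2)]
  rw [Measure.addHaar_image_linearMap, det_hexMap, abs_of_pos (by positivity)]
  calc ENNReal.ofReal (3 * √3 / 2 * R ^ 2)
      = ENNReal.ofReal (√3 / 2) * (ENNReal.ofReal (R ^ 2) * ENNReal.ofReal 3) := by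
        rw [← ENNReal.ofReal_mul (by positivity), ← ENNReal.ofReal_mul (by positivity)]
        congr 1; ring
    _ ≤ ENNReal.ofReal (√3 / 2) * volume (hexCoords R) := by
        gcongr
        calc _ ≤ ENNReal.ofReal (R ^ 2) * volume (hexCoords 1) := by
              gcongr; exact le_volume_hexCoords_one
          _ = volume (R • hexCoords 1) := h2.symm
          _ ≤ _ := measure_mono h

theorem finite_lattice_regularHexagon (c : ℝ × ℝ) (φ R : ℝ) :
    {v : ℤ × ℤ | toPlane v ∈ regularHexagon c φ R}.Finite := by
  have hb : Bornology.IsBounded (regularHexagon c φ R) :=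
    (isBounded_convexHull.2 (Set.finite_range _).isBounded)
  obtain ⟨M, hM⟩ := hb.exists_norm_le
  obtain ⟨n, hn⟩ := exists_nat_ge M
  refine (Set.finite_Icc ((-n, -n) : ℤ × ℤ) (n, n)).subset ?_
  intro v hv
  have h := (hM _ hv).trans hn
  rw [Prod.norm_def, max_le_iff, Real.norm_eq_abs, Real.norm_eq_abs, abs_le, abs_le] at h
  simp only [toPlane] at h
  exact ⟨⟨by exact_mod_cast h.1.1, by exact_mod_cast h.2.1⟩,
    ⟨by exact_mod_cast h.1.2, by exact_mod_cast h.2.2⟩⟩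

/-- The unit square has all its points in a hexagon of side length `4`. -/
theorem exists_hexCoords_four (φ : ℝ) {d : ℝ × ℝ} (h1 : |d.1| ≤ 1) (h2 : |d.2| ≤ 1) :
    ∃ b ∈ hexCoords 4, hexMap φ b = d := by
  have h3 : (1 : ℝ) ≤ √3 := by rw [Real.one_le_sqrt]; norm_num
  have bound : ∀ θ, |2 / √3 * cross d (unitVec θ)| ≤ 4 := by
    intro θ
    have hc : |cross d (unitVec θ)| ≤ 2 := by
      refine (abs_sub (d.1 * Real.sin θ) (d.2 * Real.cos θ)).trans ?_
      rw [abs_mul, abs_mul]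
      nlinarith [Real.abs_sin_le_one θ, Real.abs_cos_le_one θ, abs_nonneg d.1, abs_nonneg d.2,
        abs_nonneg (Real.sin θ), abs_nonneg (Real.cos θ)]
    have hs : |2 / √3| ≤ 2 := by
      rw [abs_of_pos (by positivity), div_le_iff₀ (by positivity)]; linarith
    rw [abs_mul]
    nlinarith [abs_nonneg (2 / √3), abs_nonneg (cross d (unitVec θ))]
  have hc := cross_unitVec φ
  have hs : √3 ≠ 0 := by positivity
  -- Cramer's rule with determinant `√3 / 2`; the sum of the coordinates is again a cross product
  -- with a unit vector, so one bound covers all three conditions.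
  refine ⟨(2 / √3 * cross d (unitVec (φ + Real.pi / 3)), -(2 / √3 * cross d (unitVec φ))),
    ⟨bound _, by rw [abs_neg]; exact bound _, ?_⟩, ?_⟩
  · have := bound (φ + 2 * (Real.pi / 3))
    rw [unitVec_add_two_mul] at this
    convert this using 2
    simp only [cross, Prod.fst_sub, Prod.snd_sub]
    ring
  · rw [hexMap_apply]
    generalize unitVec φ = a at *
    generalize unitVec (φ + Real.pi / 3) = b at *
    simp only [cross] at *
    ext <;> simp only [Prod.fst_add, Prod.snd_add, Prod.smul_fst, Prod.smul_snd, smul_eq_mul] <;>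
      field_simp
    · linear_combination 2 * d.1 * hc
    · linear_combination 2 * d.2 * hc

/-- A regular hexagon has at least as many grid points as the area of a slightly smaller one. -/
theorem exists_finset_lattice_regularHexagon (c : ℝ × ℝ) (φ : ℝ) {R : ℝ} (hR : 4 ≤ R) :
    ∃ S : Finset (ℤ × ℤ), (∀ v ∈ S, toPlane v ∈ regularHexagon c φ R) ∧
      3 * √3 / 2 * (R - 4) ^ 2 ≤ S.card := by
  have hfin := finite_lattice_regularHexagon c φ R
  refine ⟨hfin.toFinset, fun v hv => hfin.mem_toFinset.1 hv, ?_⟩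
  -- Rounding down moves a point by at most a hexagon of side 4, so the unit squares at grid points
  -- of the hexagon cover the one of side `R - 4`.
  let box : ℤ × ℤ → Set (ℝ × ℝ) := fun v =>
    Set.Ico ((v.1 : ℝ) - c.1) (v.1 - c.1 + 1) ×ˢ Set.Ico ((v.2 : ℝ) - c.2) (v.2 - c.2 + 1)
  have hvol : ∀ v, volume (box v) = 1 := by
    intro v
    simp [box, Measure.volume_eq_prod, Measure.prod_prod]
  have hcover : hexMap φ '' hexCoords (R - 4) ⊆ ⋃ v ∈ hfin.toFinset, box v := by
    rintro _ ⟨a, ha, rfl⟩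
    obtain ⟨x, hx⟩ : ∃ x, x = c + hexMap φ a := ⟨_, rfl⟩
    have f1 := Int.floor_le x.1
    have f1' := Int.lt_floor_add_one x.1
    have f2 := Int.floor_le x.2
    have f2' := Int.lt_floor_add_one x.2
    obtain ⟨b, hb, hbx⟩ := exists_hexCoords_four φ (d := x - toPlane (⌊x.1⌋, ⌊x.2⌋))
      (by simp only [toPlane, Prod.fst_sub, abs_le]; constructor <;> linarith)
      (by simp only [toPlane, Prod.snd_sub, abs_le]; constructor <;> linarith)
    have hab : a - b ∈ hexCoords R := by
      simp only [hexCoords, Set.mem_ofPred_eq, abs_le, Prod.fst_sub, Prod.snd_sub] at ha hb ⊢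
      refine ⟨⟨?_, ?_⟩, ⟨?_, ?_⟩, ⟨?_, ?_⟩⟩ <;> linarith
    rw [Set.mem_iUnion₂]
    refine ⟨(⌊x.1⌋, ⌊x.2⌋), ?_, ?_⟩
    · rw [hfin.mem_toFinset]
      have := mem_regularHexagon_of_mem_hexCoords (c := c) (φ := φ) hab
      have e : c + (hexMap φ a - (x - toPlane (⌊x.1⌋, ⌊x.2⌋))) = toPlane (⌊x.1⌋, ⌊x.2⌋) := by
        nth_rw 1 [hx]
        abel
      rwa [map_sub, hbx, e] at this
    · have e1 : x.1 = c.1 + (hexMap φ a).1 := by rw [hx]; rfl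
      have e2 : x.2 = c.2 + (hexMap φ a).2 := by rw [hx]; rfl
      refine ⟨⟨?_, ?_⟩, ⟨?_, ?_⟩⟩ <;> simp only <;> linarith
  have h := (le_volume_image_hexCoords φ (sub_nonneg.2 hR)).trans
    ((measure_mono hcover).trans (measure_biUnion_finset_le _ _))
  simp only [hvol, Finset.sum_const, nsmul_eq_mul, mul_one] at h
  rwa [← ENNReal.ofReal_natCast, ENNReal.ofReal_le_ofReal_iff (Nat.cast_nonneg _)] at h

/-! ### Choice of parameters and conclusion -/

/-- For arbitrarily large `R`, every regular hexagon of side length `R` contains a distinct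
difference configuration with nearly `√(3√3/2) R` dots. -/
theorem exists_large_isDDC (φ : ℝ) {ε : ℝ} (hε : 0 < ε) (M : ℝ) :
    ∃ R : ℝ, 0 < R ∧ M ≤ R ∧ ∀ c : ℝ × ℝ, ∃ D : Finset (ℤ × ℤ), IsDDC D ∧
      (∀ v ∈ D, toPlane v ∈ regularHexagon c φ R) ∧
      √(3 * √3 / 2) * (1 - ε) * R ≤ D.card := by
  obtain ⟨A, hA⟩ : ∃ A, A = √(3 * √3 / 2) := ⟨_, rfl⟩
  have hA0 : 0 < A := by rw [hA]; positivity
  have hA2 : A ^ 2 = 3 * √3 / 2 := by rw [hA, Real.sq_sqrt (by positivity)]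
  obtain ⟨τ, hτ⟩ : ∃ τ, τ = max (1 - ε / 2) (1 / 2) := ⟨_, rfl⟩
  have hτ1 : τ < 1 := by rw [hτ]; exact max_lt (by linarith) (by norm_num)
  have hτ2 : 1 / 2 ≤ τ := by rw [hτ]; exact le_max_right _ _
  have hτ3 : 1 - ε / 2 ≤ τ := by rw [hτ]; exact le_max_left _ _
  set e₀ := unitVec φ with he₀
  set e₁ := unitVec (φ + Real.pi / 3) with he₁
  have hc : cross e₀ e₁ = A ^ 2 / 3 := by rw [hA2, he₀, he₁, cross_unitVec]; ring
  -- Sums of adjacent vertices generate the translations of the hexagonal tiling; `1 / A` is the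
  -- side of the hexagon of area 1.
  have hw : cross ((1 / A) • (e₀ + e₁)) ((1 / A) • ((2 : ℝ) • e₁ - e₀)) = 1 := by
    have h : cross ((1 / A) • (e₀ + e₁)) ((1 / A) • ((2 : ℝ) • e₁ - e₀)) = 3 / A ^ 2 * cross e₀ e₁ := by
      simp only [cross, Prod.smul_fst, Prod.smul_snd, Prod.fst_add, Prod.snd_add, Prod.fst_sub,
        Prod.snd_sub, smul_eq_mul]
      field_simp
      ring
    rw [h, hc]
    field_simp
  obtain ⟨n, hn⟩ := exists_nat_gt (2 * A * (max M (max 4 (16 / ε))))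
  obtain ⟨p, g, u, hp, hnp, H⟩ := exists_prime_forms hw (by linarith) hτ1 n
  have : Fact p.Prime := ⟨hp⟩
  have hp0 : (0 : ℝ) < p := by exact_mod_cast hp.pos
  -- Side `p / A` would tile along `p ⟨w₁, w₂⟩`; the factor `τ` leaves room for the lattice error.
  obtain ⟨R, hR⟩ : ∃ R, R = τ * p / A := ⟨_, rfl⟩
  have hRA : R * A = τ * p := by rw [hR]; field_simp
  have hRlarge : max M (max 4 (16 / ε)) ≤ R := by
    have h1 : (n : ℝ) < p := by exact_mod_cast hnp
    rw [hR, le_div_iff₀ hA0]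
    nlinarith
  have hRM : M ≤ R := (le_max_left _ _).trans hRlarge
  have hR4 : 4 ≤ R := ((le_max_left _ _).trans (le_max_right _ _)).trans hRlarge
  have hRε : 16 / ε ≤ R := ((le_max_right _ _).trans (le_max_right _ _)).trans hRlarge
  refine ⟨R, by linarith, hRM, fun c => ?_⟩
  obtain ⟨S, hS, hcard⟩ := exists_finset_lattice_regularHexagon c φ hR4
  obtain ⟨D, hDS, hD, hDcard⟩ := exists_isDDC_subset (p := p) g u S (by
    intro v hv w hw hvw1 hvw2
    obtain ⟨a, ⟨ha1, ha2, ha3⟩, hva⟩ :=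
      exists_hexCoords_of_mem_regularHexagon (by linarith) (hS v hv)
    obtain ⟨b, ⟨hb1, hb2, hb3⟩, hwb⟩ :=
      exists_hexCoords_of_mem_regularHexagon (by linarith) (hS w hw)
    have hsub : toPlane (v - w) = (a.1 - b.1) • e₀ + (a.2 - b.2) • e₁ := by
      have : toPlane (v - w) = toPlane v - toPlane w := by simp [toPlane]
      rw [this, hva, hwb, hexMap_apply, hexMap_apply]
      module
    have hx : cross (toPlane (v - w)) ((1 / A) • ((2 : ℝ) • e₁ - e₀)) =
        A / 3 * (2 * (a.1 - b.1) + (a.2 - b.2)) := by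
      have h : cross (toPlane (v - w)) ((1 / A) • ((2 : ℝ) • e₁ - e₀)) =
          (2 * (a.1 - b.1) + (a.2 - b.2)) / A * cross e₀ e₁ := by
        rw [hsub]
        simp only [cross, Prod.smul_fst, Prod.smul_snd, Prod.fst_add, Prod.snd_add, Prod.fst_sub,
          Prod.snd_sub, smul_eq_mul]
        field_simp
        ring
      rw [h, hc]
      field_simp
    have hy : cross ((1 / A) • (e₀ + e₁)) (toPlane (v - w)) =
        A / 3 * ((a.2 - b.2) - (a.1 - b.1)) := by
      have h : cross ((1 / A) • (e₀ + e₁)) (toPlane (v - w)) =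
          ((a.2 - b.2) - (a.1 - b.1)) / A * cross e₀ e₁ := by
        rw [hsub]
        simp only [cross, Prod.smul_fst, Prod.smul_snd, Prod.fst_add, Prod.snd_add, smul_eq_mul]
        field_simp
        ring
      rw [h, hc]
      field_simp
    have bound : ∀ s t r : ℝ, |s| ≤ R → |t| ≤ R → r = A * (s - t) → |r| ≤ 2 * τ * p := by
      rintro s t r hs ht rfl
      rw [abs_mul, abs_of_pos hA0]
      have : |s - t| ≤ 2 * R := (abs_sub s t).trans (by linarith)
      nlinarith
    refine sub_eq_zero.1 (H _ hvw1 hvw2 ?_ ?_ ?_)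
    · exact bound _ _ _ ha1 hb1 (by rw [hx, hy]; ring)
    · exact bound _ _ _ ha2 hb2 (by rw [hx, hy]; ring)
    · exact bound _ _ _ ha3 hb3 (by rw [hx, hy]; ring))
  refine ⟨D, hD, fun v hv => hS v (hDS hv), le_trans ?_ hDcard⟩
  rw [le_div_iff₀ hp0, ← hA]
  refine le_trans ?_ hcard
  rw [← hA2]
  have hεR : 16 ≤ R * ε := (div_le_iff₀ hε).1 hRε
  -- Half of `ε` is spent on `τ`; the other half pays for the boundary loss `8 R`, since `16 ≤ R *
  -- ε`.
  have key : (1 - ε) * R ^ 2 ≤ τ * (R - 4) ^ 2 := by nlinarith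
  have h1 : τ * (A * (1 - ε) * R * p) ≤ τ * (A ^ 2 * (R - 4) ^ 2) := by
    calc τ * (A * (1 - ε) * R * p) = A * (1 - ε) * R * (R * A) := by rw [hRA]; ring
      _ = A ^ 2 * ((1 - ε) * R ^ 2) := by ring
      _ ≤ A ^ 2 * (τ * (R - 4) ^ 2) := by gcongr
      _ = _ := by ring
  exact le_of_mul_le_mul_left h1 (by linarith)

theorem mainTheorem7 (φ : ℝ) :
    ∃ R e : ℕ → ℝ,
      (∀ k, 0 < R k) ∧
      Filter.Tendsto R Filter.atTop Filter.atTop ∧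
      Asymptotics.IsLittleO Filter.atTop e R ∧
      ∀ (k : ℕ) (c : ℝ × ℝ), ∃ D : Finset (ℤ × ℤ),
        IsDDC D ∧
        (∀ p ∈ D, ((p.1 : ℝ), (p.2 : ℝ)) ∈ regularHexagon c φ (R k)) ∧
        √(3 * √3 / 2) * R k + e k ≤ (D.card : ℝ) := by
  choose R hR0 hRk hR using fun k : ℕ =>
    exists_large_isDDC φ (Nat.one_div_pos_of_nat (α := ℝ) (n := k)) k
  refine ⟨R, fun k => (-√(3 * √3 / 2) * (1 / ((k : ℝ) + 1))) * R k, hR0,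
    Filter.tendsto_atTop_mono hRk tendsto_natCast_atTop_atTop, ?_, fun k c => ?_⟩
  · have h : Filter.Tendsto (fun k : ℕ => -√(3 * √3 / 2) * (1 / ((k : ℝ) + 1))) Filter.atTop
        (nhds 0) := by
      simpa using tendsto_one_div_add_atTop_nhds_zero_nat.const_mul (-√(3 * √3 / 2))
    simpa using ((Asymptotics.isLittleO_one_iff ℝ).2 h).mul_isBigO (Asymptotics.isBigO_refl R _)
  · obtain ⟨D, h1, h2, h3⟩ := hR k c
    refine ⟨D, h1, h2, le_trans (le_of_eq ?_) h3⟩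
    ring
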